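/- **Theorem (Nonlinear Cascade Estimator).** Consider the cascade $$\dot\eta=f(\eta),\qquad \dot x=Ax+Bh(\eta)+B\bar u,\qquad y=Cx,$$ with $A\in\mathbb R^{n\times n}$, $B\in\mathbb R^{n\times m}$, $C\in\mathbb R^{p\times n}$, $f:\mathbb R^\nu\to\mathbb R^\nu$, $h:\mathbb R^\nu\to\mathbb R^m$ and a measured, locally integrable input $\bar u:[0,\infty)\to\mathbb R^m$ (solutions of differential equations are meant in the sense of Carathéodory). Assume: * (A0) $f$ and $h$ are continuously differentiable and $f(0)=0$, $h(0)=0$; * (A1) $\mathcal O\subset\mathbb R^\nu$ is open, contains the origin and is forward invariant for $\dot\eta=f(\eta)$: the (unique) solution starting at any point of $\mathcal O$ exists on $[0,\infty)$ and stays in $\mathcal O$; * (A2) $A$ is Hurwitz. Let $\pi=\mathcal s_{\rm p}^{-1}(Bh)$, that is, $\pi:\mathbb R^\nu\to\mathbb R^n$ is a continuously differentiable solution of the invariance equation $$\tfrac{\partial\pi}{\partial\eta}(\eta)f(\eta)-A\pi(\eta)=Bh(\eta)\quad(\eta\in\mathbb R^\nu),\qquad \pi(0)=0,$$ and let $\mathcal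 c_{\rm p}(h)(\eta)=C\pi(\eta)$. Assume further: * (O1) there are $L\in\mathbb R^{p\times\nu}$, a $C^1$ function $\psi:\mathbb R^p\to\mathbb R^p$ and a symmetric $R\in\mathbb R^{p\times p}$, $R\succ0$, with $\mathcal c_{\rm p}(h)(\eta)=\psi(L\eta)$ for all $\eta\in\mathbb R^\nu$ and $R\frac{\partial\psi}{\partial s}(s)+\frac{\partial\psi}{\partial s}(s)^{\sf T}R\succeq 2I_p$ for all $s\in\mathbb R^p$; * (O2) there are a symmetric $P\in\mathbb R^{\nu\times\nu}$, $P\succ0$, and $\varrho,\varepsilon>0$ with $P\frac{\partial f}{\partial\eta}(\eta)+\frac{\partial f}{\partial\eta}(\eta)^{\sf T}P-2\varrho L^{\sf T}L\preceq-2\varepsilon I_\nu$ for all $\eta\in\mathbb R^\nu$. Set $K_\eta=\kappa P^{-1}L^{\sf T}R$ with any $\kappa\ge\varrho$, and consider the observer $$\dot{\hat x}=A\hat x+Bh(\hat\eta)+B\bar u-w_x,\quad \dot{\hat\eta}=f(\hat\eta)-w_\eta,\quad w_\eta=K_\eta(C\hat x-y),\quad w_x=\tfrac{\partial\pi}{\partial\eta}(\hat\eta)\,w_\eta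 .$$ Then for all $(x(0),\eta(0))\in\mathbb R^n\times\mathcal O$ the cascade has a solution on $[0,\infty)$, for each such solution and all $(\hat\xi(0),\hat\eta(0))\in\mathbb R^n\times\mathcal O$ the observer has a solution on $[0,\infty)$ with these initial values, where $\hat\xi=\hat x-\pi(\hat\eta)$, and all these solutions satisfy, with $\xi=x-\pi(\eta)$, $$\lim_{t\to\infty}\;|\hat\xi(t)-\xi(t)|+|\hat\eta(t)-\eta(t)|=0 .$$ If moreover the generator trajectory $\eta$ is bounded on $[0,\infty)$, or $\pi$ is uniformly continuous on $\mathbb R^\nu$, then $$\lim_{t\to\infty}\;|\hat x(t)-x(t)|+|\hat\eta(t)-\eta(t)|=0 .$$ -/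

import Mathlib

open Matrix MeasureTheory Filter Topology Set

/-- Jacobian matrix `∂f/∂x (x)` of a map `f : ℝᵃ → ℝᵇ` (the matrix of its Fréchet derivative). -/
noncomputable def jacobian {a b : ℕ} (f : (Fin a → ℝ) → (Fin b → ℝ)) (x : Fin a → ℝ) :
    Matrix (Fin b) (Fin a) ℝ :=
  LinearMap.toMatrix' (fderiv ℝ f x : (Fin a → ℝ) →ₗ[ℝ] (Fin b → ℝ))

/-- Euclidean norm of a vector of `ℝᵃ`. -/
noncomputable def euclNorm {a : ℕ} (v : Fin a → ℝ) : ℝ := ‖WithLp.toLp 2 v‖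

/-- A real square matrix is Hurwitz: all its complex eigenvalues have negative real part. -/
def IsHurwitz {n : ℕ} (A : Matrix (Fin n) (Fin n) ℝ) : Prop :=
  ∀ μ ∈ spectrum ℂ (A.map (algebraMap ℝ ℂ)), μ.re < 0

/-- `z` solves `ż = F(t, z)` on `[0, ∞)` in the sense of Carathéodory: it is continuous, and it
satisfies the integral equation, whose integrand is integrable on bounded intervals. If
`t ↦ F(t, z(t))` is continuous, then these are exactly the `C¹` solutions. -/
def IsSolution {a : ℕ} (F : ℝ → (Fin a → ℝ) → (Fin a → ℝ)) (z : ℝ → Fin a → ℝ) : Prop :=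
  ContinuousOn z (Ici 0) ∧
    ∀ t, 0 ≤ t → IntervalIntegrable (fun s => F s (z s)) volume 0 t ∧
      z t = z 0 + ∫ s in (0 : ℝ)..t, F s (z s)

/-- The primal invariance operator `s_p(π)(η) = ∂π/∂η(η) f(η) - A π(η)`. -/
noncomputable def primalInvarianceOp {n ν : ℕ} (A : Matrix (Fin n) (Fin n) ℝ)
    (f : (Fin ν → ℝ) → (Fin ν → ℝ)) (π : (Fin ν → ℝ) → (Fin n → ℝ)) (η : Fin ν → ℝ) : Fin n → ℝ :=
  jacobian π η *ᵥ f η - A *ᵥ π η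

/-- `π = s_p⁻¹(B h)`: `π` is a continuously differentiable solution of the invariance equation
`s_p(π) = B h` on the whole of `ℝ^ν`, with `π(0) = 0`. -/
structure SolvesInvariance {n m ν : ℕ} (A : Matrix (Fin n) (Fin n) ℝ)
    (B : Matrix (Fin n) (Fin m) ℝ) (f : (Fin ν → ℝ) → (Fin ν → ℝ))
    (h : (Fin ν → ℝ) → (Fin m → ℝ)) (π : (Fin ν → ℝ) → (Fin n → ℝ)) : Prop where
  contDiff : ContDiff ℝ 1 π
  map_zero : π 0 = 0
  eqn : ∀ η, primalInvarianceOp A f π η = B *ᵥ h η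

/-- The primal nonlinear steady-state cascade operator `c_p(h)(η) = C π(η) + D h(η)`, where
`π = s_p⁻¹(B h)`. -/
def primalSSC {n m p ν : ℕ} (C : Matrix (Fin p) (Fin n) ℝ) (D : Matrix (Fin p) (Fin m) ℝ)
    (h : (Fin ν → ℝ) → (Fin m → ℝ)) (π : (Fin ν → ℝ) → (Fin n → ℝ)) (η : Fin ν → ℝ) : Fin p → ℝ :=
  C *ᵥ π η + D *ᵥ h η

/-- (A0): `f` and `h` are continuously differentiable and vanish at the origin. -/
structure SmoothGenerator {m ν : ℕ} (f : (Fin ν → ℝ) → (Fin ν → ℝ))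
    (h : (Fin ν → ℝ) → (Fin m → ℝ)) : Prop where
  contDiff_f : ContDiff ℝ 1 f
  contDiff_h : ContDiff ℝ 1 h
  f_zero : f 0 = 0
  h_zero : h 0 = 0

/-- (A1): `O` is an open set containing the origin that is forward invariant for `η̇ = f(η)`: the
solution (unique when `f` is `C¹`) that starts at a point of `O` exists on `[0, ∞)` and stays
in `O`. -/
structure IsForwardInvariantDomain {ν : ℕ} (f : (Fin ν → ℝ) → (Fin ν → ℝ))
    (O : Set (Fin ν → ℝ)) : Prop where
  isOpen : IsOpen O
  zero_mem : (0 : Fin ν → ℝ) ∈ O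
  forward : ∀ η₀ ∈ O, ∃ η : ℝ → Fin ν → ℝ,
    IsSolution (fun _ => f) η ∧ η 0 = η₀ ∧ ∀ t, 0 ≤ t → η t ∈ O

/-- (O1): `c(η) = ψ(L η)`, where `ψ` is `C¹` and strongly monotone in the metric `R ≻ 0`, i.e.
`R ∂ψ/∂s + (∂ψ/∂s)ᵀ R ⪰ 2 I`. -/
structure MonotoneOutput {p ν : ℕ} (c : (Fin ν → ℝ) → (Fin p → ℝ)) (L : Matrix (Fin p) (Fin ν) ℝ)
    (ψ : (Fin p → ℝ) → (Fin p → ℝ)) (R : Matrix (Fin p) (Fin p) ℝ) : Prop where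
  contDiff : ContDiff ℝ 1 ψ
  posDef : R.PosDef
  factor : ∀ η, c η = ψ (L *ᵥ η)
  monotone : ∀ s, (R * jacobian ψ s + (jacobian ψ s)ᵀ * R
    - (2 : ℝ) • (1 : Matrix (Fin p) (Fin p) ℝ)).PosSemidef

/-- (O2): `P ∂f/∂η + (∂f/∂η)ᵀ P - 2 ϱ Lᵀ L ⪯ - 2 ε I` on `ℝ^ν`, where `P ≻ 0` and
`ϱ, ε > 0`. -/
structure DifferentialDetectability {p ν : ℕ} (f : (Fin ν → ℝ) → (Fin ν → ℝ))
    (L : Matrix (Fin p) (Fin ν) ℝ) (P : Matrix (Fin ν) (Fin ν) ℝ) (ϱ ε : ℝ) : Prop where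
  posDef : P.PosDef
  rho_pos : 0 < ϱ
  eps_pos : 0 < ε
  lmi : ∀ η, (-((2 * ε) • (1 : Matrix (Fin ν) (Fin ν) ℝ))
    - (P * jacobian f η + (jacobian f η)ᵀ * P - (2 * ϱ) • (Lᵀ * L))).PosSemidef

/-- The gain `K_η = κ P⁻¹ Lᵀ R`. -/
noncomputable def observerGain {p ν : ℕ} (κ : ℝ) (P : Matrix (Fin ν) (Fin ν) ℝ)
    (L : Matrix (Fin p) (Fin ν) ℝ) (R : Matrix (Fin p) (Fin p) ℝ) : Matrix (Fin ν) (Fin p) ℝ :=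
  κ • (P⁻¹ * Lᵀ * R)

/-- `(x, η)` is a trajectory on `[0, ∞)` of the cascade
`η̇ = f(η)`, `ẋ = A x + B h(η) + B ū`. -/
structure IsPlantTrajectory {n m ν : ℕ} (A : Matrix (Fin n) (Fin n) ℝ)
    (B : Matrix (Fin n) (Fin m) ℝ) (f : (Fin ν → ℝ) → (Fin ν → ℝ))
    (h : (Fin ν → ℝ) → (Fin m → ℝ)) (ubar : ℝ → Fin m → ℝ)
    (x : ℝ → Fin n → ℝ) (η : ℝ → Fin ν → ℝ) : Prop where
  generator : IsSolution (fun _ z => f z) η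
  plant : IsSolution (fun t z => A *ᵥ z + B *ᵥ h (η t) + B *ᵥ ubar t) x

/-- The output correction `w_η = K (ŷ - y)`, where `ŷ = C x̂`. -/
def correctionEta {n p ν : ℕ} (C : Matrix (Fin p) (Fin n) ℝ) (K : Matrix (Fin ν) (Fin p) ℝ)
    (y : Fin p → ℝ) (xhat : Fin n → ℝ) : Fin ν → ℝ :=
  K *ᵥ (C *ᵥ xhat - y)

/-- The output correction `w_x = ∂π/∂η(η̂) w_η`. -/
noncomputable def correctionX {n p ν : ℕ} (C : Matrix (Fin p) (Fin n) ℝ)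
    (K : Matrix (Fin ν) (Fin p) ℝ) (π : (Fin ν → ℝ) → (Fin n → ℝ))
    (y : Fin p → ℝ) (xhat : Fin n → ℝ) (etahat : Fin ν → ℝ) : Fin n → ℝ :=
  jacobian π etahat *ᵥ correctionEta C K y xhat

/-- `(x̂, η̂)` is a trajectory on `[0, ∞)` of the observer
`x̂' = A x̂ + B h(η̂) + B ū - w_x`, `η̂' = f(η̂) - w_η`, driven by the signals `ū` and `y`. -/
structure IsObserverTrajectory {n m p ν : ℕ} (A : Matrix (Fin n) (Fin n) ℝ)
    (B : Matrix (Fin n) (Fin m) ℝ) (C : Matrix (Fin p) (Fin n) ℝ)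
    (f : (Fin ν → ℝ) → (Fin ν → ℝ)) (h : (Fin ν → ℝ) → (Fin m → ℝ))
    (π : (Fin ν → ℝ) → (Fin n → ℝ)) (K : Matrix (Fin ν) (Fin p) ℝ)
    (ubar : ℝ → Fin m → ℝ) (y : ℝ → Fin p → ℝ)
    (xhat : ℝ → Fin n → ℝ) (etahat : ℝ → Fin ν → ℝ) : Prop where
  state : IsSolution (fun t z => A *ᵥ z + B *ᵥ h (etahat t) + B *ᵥ ubar t
    - correctionX C K π (y t) z (etahat t)) xhat
  generator : IsSolution (fun t z => f z - correctionEta C K (y t) (xhat t)) etahat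

/-!
In the coordinates `ξ = x - π(η)` and `ξ̂ = x̂ - π(η̂)` the invariance equation decouples the plant and
the observer from their generators: both `ξ` and `ξ̂` satisfy `ξ̇ = A ξ + B ū`, since the correction
`w_x = ∂π/∂η(η̂) w_η` is exactly what the correction `w_η` contributes to the derivative of `π(η̂)`.
Hence `e = ξ̂ - ξ` solves `ė = A e` (`hasDerivAt_estimation_error`) and vanishes at infinity because
`A` is Hurwitz (`IsHurwitz.tendsto_zero`).

The output error is `C x̂ - y = C e + ψ(L η̂) - ψ(L η)`, so the generator part of the observer reads
`η̂' = F(η̂) + γ(t)` with `F(z) = f(z) - K_η ψ(L z)` and a continuous `γ`. By the mean value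
theorem along segments the two matrix inequalities imply that `F` is strongly dissipative in the
metric `P`,
`(z - w) ⬝ P (F z - F w) ≤ -ε |z - w|²` (`corrected_generator_dissipative`). From this follow:

* existence of the observer trajectory on `[0, ∞)` (`exists_global_solution`): the quadratic form `P`
  yields a bound on every compact time interval which is insensitive to cutoffs of the vector field,
  so the Picard–Lindelöf theorem, applied to the field cut off outside a large ball, gives solutions
  on arbitrarily long intervals, and these agree by uniqueness;
* convergence (`tendsto_zero_of_dissipative`): `η̂ - η` solves a strongly dissipative equation that is
  perturbed by the vanishing term `-K_η C e`.

The locally integrable input `ū` enters only additively: its indefinite integral is subtracted from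
`x` to construct plant trajectories, and it cancels in `x̂ - x`. So only differential equations with
continuous right-hand sides have to be solved. The decay of `x̂ - x` follows from that of `e` and of
`π(η̂) - π(η)` (`tendsto_sub_of_isBounded_or_uniformContinuous`).
-/

/-! ### Differential inequalities -/

/-- Grönwall's inequality for a function that need not be differentiable at the end points. The
constant `a` may have any sign. -/
theorem le_mul_exp_of_deriv_le {V V' : ℝ → ℝ} {a s T : ℝ} (hc : ContinuousOn V (Icc s T))
    (hd : ∀ t ∈ Ioo s T, HasDerivAt V (V' t) t) (hle : ∀ t ∈ Ioo s T, V' t ≤ a * V t) :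
    ∀ t ∈ Icc s T, V t ≤ V s * Real.exp (a * (t - s)) := by
  have hexp : ∀ t, HasDerivAt (fun t => Real.exp (-(a * (t - s))))
      (Real.exp (-(a * (t - s))) * -(a * 1)) t := fun t =>
    ((((hasDerivAt_id t).sub_const s).const_mul a).neg).exp
  have hW : ∀ t ∈ Ioo s T, HasDerivAt (fun t => V t * Real.exp (-(a * (t - s))))
      (V' t * Real.exp (-(a * (t - s))) + V t * (Real.exp (-(a * (t - s))) * -(a * 1))) t :=
    fun t ht => (hd t ht).mul (hexp t)
  have hanti : AntitoneOn (fun t => V t * Real.exp (-(a * (t - s)))) (Icc s T) := by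
    refine antitoneOn_of_deriv_nonpos (convex_Icc s T) (hc.mul (by fun_prop)) ?_ ?_
    · rw [interior_Icc]
      exact fun t ht => (hW t ht).differentiableAt.differentiableWithinAt
    · rw [interior_Icc]
      intro t ht
      rw [(hW t ht).deriv]
      nlinarith [hle t ht, Real.exp_pos (-(a * (t - s)))]
  intro t ht
  have h := hanti ⟨le_rfl, ht.1.trans ht.2⟩ ht ht.1
  simp only [sub_self, mul_zero, neg_zero, Real.exp_zero, mul_one, Real.exp_neg] at h
  rwa [← div_eq_mul_inv, div_le_iff₀ (Real.exp_pos _)] at h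

/-- Input-to-state stability of the scalar comparison equation: a vanishing input yields a
vanishing state. -/
theorem tendsto_zero_of_deriv_le {V V' g : ℝ → ℝ} {a : ℝ} (ha : 0 < a)
    (hc : ContinuousOn V (Ici 0)) (hd : ∀ t, 0 < t → HasDerivAt V (V' t) t)
    (hle : ∀ t, 0 < t → V' t ≤ -a * V t + g t) (hg : Tendsto g atTop (𝓝 0))
    (h0 : ∀ t, 0 ≤ t → 0 ≤ V t) : Tendsto V atTop (𝓝 0) := by
  rw [Metric.tendsto_atTop]
  intro δ hδ
  obtain ⟨T₀, hT₀⟩ := (hg.eventually (gt_mem_nhds (show (0 : ℝ) < a * (δ / 2) by positivity))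
    ).exists_forall_of_atTop
  set s := max T₀ 0
  -- past time `s` the input is below `a δ / 2`, so `V - δ / 2` decays exponentially
  have hdecay : ∀ t, s ≤ t → V t - δ / 2 ≤ (V s - δ / 2) * Real.exp (-a * (t - s)) := by
    intro t ht
    have hs0 : (0 : ℝ) ≤ s := le_max_right _ _
    refine le_mul_exp_of_deriv_le (V := fun t => V t - δ / 2) (V' := V') (T := t) ?_ ?_ ?_ t
      ⟨ht, le_rfl⟩
    · exact (hc.mono fun r hr => hs0.trans hr.1).sub continuousOn_const
    · exact fun r hr => (hd r (hs0.trans_lt hr.1)).sub_const _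
    · intro r hr
      have h1 := hle r (hs0.trans_lt hr.1)
      have h2 := hT₀ r ((le_max_left _ _).trans hr.1.le)
      nlinarith
  have hlim : Tendsto (fun t => (V s - δ / 2) * Real.exp (-a * (t - s))) atTop (𝓝 0) := by
    have : Tendsto (fun t => -a * (t - s)) atTop atBot :=
      (tendsto_atTop_add_const_right _ (-s) tendsto_id).const_mul_atTop_of_neg (by linarith)
    simpa using (Real.tendsto_exp_atBot.comp this).const_mul (V s - δ / 2)
  obtain ⟨T₁, hT₁⟩ := (hlim.eventually (gt_mem_nhds (show (0 : ℝ) < δ / 2 by positivity))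
    ).exists_forall_of_atTop
  refine ⟨max s T₁, fun t ht => ?_⟩
  have hst : s ≤ t := (le_max_left _ _).trans ht
  have h1 := hdecay t hst
  have h2 := hT₁ t ((le_max_right _ _).trans ht)
  have h3 := h0 t ((le_max_right _ _).trans hst)
  rw [Real.dist_eq, sub_zero, abs_of_nonneg h3]
  linarith

/-! ### Asymptotic stability of Hurwitz systems -/

/-- A stable scalar complex equation maps vanishing inputs to vanishing states. -/
theorem tendsto_zero_of_stable_scalar {z w : ℝ → ℂ} {μ : ℂ} (hμ : μ.re < 0)
    (hc : ContinuousOn z (Ici 0)) (hd : ∀ t, 0 < t → HasDerivAt z (μ * z t + w t) t)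
    (hw : Tendsto w atTop (𝓝 0)) : Tendsto z atTop (𝓝 0) := by
  have hV : Tendsto (fun t => ‖z t‖ ^ 2) atTop (𝓝 0) := by
    refine tendsto_zero_of_deriv_le (a := -μ.re) (g := fun t => ‖w t‖ ^ 2 / (-μ.re))
      (by linarith) (hc.norm.pow 2) (fun t ht => (hd t ht).norm_sq) ?_ ?_ (fun t _ => by positivity)
    · intro t _
      have h1 : inner ℝ (z t) (μ * z t + w t) = μ.re * ‖z t‖ ^ 2 + inner ℝ (z t) (w t) := by
        rw [inner_add_right, Complex.inner, Complex.sq_norm, Complex.normSq_apply]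
        congr 1
        simp
        ring
      have h2 := real_inner_le_norm (z t) (w t)
      have hm : 0 < -μ.re := by linarith
      have hm' : μ.re ≠ 0 := hμ.ne
      have h3 : 2 * (‖z t‖ * ‖w t‖) ≤ (-μ.re) * ‖z t‖ ^ 2 + ‖w t‖ ^ 2 / (-μ.re) := by
        have h4 : (-μ.re) * ‖z t‖ ^ 2 + ‖w t‖ ^ 2 / (-μ.re) - 2 * (‖z t‖ * ‖w t‖)
            = (-μ.re * ‖z t‖ - ‖w t‖) ^ 2 / (-μ.re) := by
          field_simp
          ring
        have h5 : 0 ≤ (-μ.re * ‖z t‖ - ‖w t‖) ^ 2 / (-μ.re) := by positivity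
        linarith
      rw [h1]
      linarith
    · simpa using (hw.norm.pow 2).div_const (-μ.re)
  rw [tendsto_zero_iff_norm_tendsto_zero]
  simpa using hV.sqrt

theorem hasDerivAt_mulVec {𝕜 : Type*} [RCLike 𝕜] {a b : ℕ} (M : Matrix (Fin b) (Fin a) 𝕜)
    {z : ℝ → Fin a → 𝕜} {z' : Fin a → 𝕜} {t : ℝ} (hz : HasDerivAt z z' t) :
    HasDerivAt (fun s => M *ᵥ z s) (M *ᵥ z') t := by
  rw [hasDerivAt_pi]
  intro i
  simp only [Matrix.mulVec, dotProduct]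
  exact HasDerivAt.fun_sum fun j _ => ((hasDerivAt_pi.1 hz j).const_mul (M i j))

theorem continuousOn_mulVec {𝕜 : Type*} [RCLike 𝕜] {a b : ℕ} (M : Matrix (Fin b) (Fin a) 𝕜)
    {z : ℝ → Fin a → 𝕜} {S : Set ℝ} (hz : ContinuousOn z S) :
    ContinuousOn (fun s => M *ᵥ z s) S :=
  (Continuous.matrix_mulVec continuous_const continuous_id).comp_continuousOn hz

/-- Solutions of `ż = M z` that are annihilated by a product of factors `M - λ` with
`Re λ < 0` vanish at infinity: `w = (M - λ) z` is a solution annihilated by one factor fewer, and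
`ż = λ z + w`. -/
theorem tendsto_zero_of_annihilated {n : ℕ} (M : Matrix (Fin n) (Fin n) ℂ) (l : List ℂ)
    (hl : ∀ μ ∈ l, μ.re < 0) (z : ℝ → Fin n → ℂ) (hc : ContinuousOn z (Ici 0))
    (hd : ∀ t, 0 < t → HasDerivAt z (M *ᵥ z t) t)
    (hz : ∀ t, (l.map fun μ => M - Matrix.scalar (Fin n) μ).prod *ᵥ z t = 0) :
    Tendsto z atTop (𝓝 0) := by
  induction l generalizing z with
  | nil =>
    have : z = fun _ => 0 := funext fun t => by simpa using hz t
    rw [this]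
    exact tendsto_const_nhds
  | cons μ l ih =>
    have hcomm : ∀ N : Matrix (Fin n) (Fin n) ℂ, N ∈ l.map (fun μ => M - Matrix.scalar (Fin n) μ) →
        Commute (M - Matrix.scalar (Fin n) μ) N := by
      intro N hN
      obtain ⟨μ', -, rfl⟩ := List.mem_map.1 hN
      have h1 : ∀ (c : ℂ) (N : Matrix (Fin n) (Fin n) ℂ), Commute (Matrix.scalar (Fin n) c) N :=
        fun c N => Matrix.scalar_commute c (fun _ => Commute.all _ _) N
      exact ((Commute.refl M).sub_right (h1 μ' M).symm).sub_left (h1 μ _)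
    have hw := ih (fun μ' h => hl μ' (List.mem_cons_of_mem _ h))
      (fun t => (M - Matrix.scalar (Fin n) μ) *ᵥ z t) (continuousOn_mulVec _ hc)
      (fun t ht => by
        have h1 := hasDerivAt_mulVec (M - Matrix.scalar (Fin n) μ) (hd t ht)
        have h2 : (M - Matrix.scalar (Fin n) μ) *ᵥ (M *ᵥ z t)
            = M *ᵥ ((M - Matrix.scalar (Fin n) μ) *ᵥ z t) := by
          rw [Matrix.mulVec_mulVec, Matrix.mulVec_mulVec]
          congr 1
          exact ((Commute.refl M).sub_left (Matrix.scalar_commute μ (fun _ => Commute.all _ _) M))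
        rwa [h2] at h1)
      (fun t => by
        have h1 := hz t
        rw [List.map_cons, List.prod_cons, (Commute.list_prod_right _ _ hcomm).eq,
          ← Matrix.mulVec_mulVec] at h1
        exact h1)
    rw [tendsto_pi_nhds] at hw ⊢
    intro i
    refine tendsto_zero_of_stable_scalar (hl μ List.mem_cons_self)
      (w := fun t => ((M - Matrix.scalar (Fin n) μ) *ᵥ z t) i)
      ((continuous_apply i).comp_continuousOn hc) (fun t ht => ?_) (hw i)
    have h1 := hasDerivAt_pi.1 (hd t ht) i
    have h2 : (M *ᵥ z t) i = μ * z t i + ((M - Matrix.scalar (Fin n) μ) *ᵥ z t) i := by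
      rw [Matrix.sub_mulVec, Pi.sub_apply, Matrix.scalar_apply, Matrix.mulVec_diagonal]
      ring
    rw [h2] at h1
    exact h1

/-- Every solution of `ż = A z` vanishes at infinity if `A` is Hurwitz. By the Cayley–Hamilton
theorem the complexified solution is annihilated by the product of the factors `A - λ` over the
roots `λ` of the characteristic polynomial. -/
theorem IsHurwitz.tendsto_zero {n : ℕ} {A : Matrix (Fin n) (Fin n) ℝ} (hA : IsHurwitz A)
    {z : ℝ → Fin n → ℝ} (hc : ContinuousOn z (Ici 0))
    (hd : ∀ t, 0 < t → HasDerivAt z (A *ᵥ z t) t) : Tendsto z atTop (𝓝 0) := by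
  set M : Matrix (Fin n) (Fin n) ℂ := A.map (algebraMap ℝ ℂ) with hM
  have hsplit := (IsAlgClosed.splits M.charpoly)
  have hprod : M.charpoly
      = (M.charpoly.roots.toList.map fun μ => Polynomial.X - Polynomial.C μ).prod := by
    conv_lhs => rw [hsplit.eq_prod_roots_of_monic M.charpoly_monic]
    conv_lhs => rw [← Multiset.coe_toList M.charpoly.roots, Multiset.map_coe, Multiset.prod_coe]
  have hCH : (M.charpoly.roots.toList.map fun μ => M - Matrix.scalar (Fin n) μ).prod = 0 := by
    have h1 := Matrix.aeval_self_charpoly M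
    rw [hprod, map_list_prod, List.map_map] at h1
    rw [← h1]
    congr 1
    refine List.map_congr_left fun μ _ => ?_
    simp only [Function.comp_apply, map_sub, Polynomial.aeval_X, Polynomial.aeval_C]
    rfl
  have hlim := tendsto_zero_of_annihilated M M.charpoly.roots.toList
    (fun μ hμ => hA μ (by
      rw [Matrix.mem_spectrum_iff_isRoot_charpoly]
      exact Polynomial.isRoot_of_mem_roots (Multiset.mem_toList.1 hμ)))
    (fun t i => (z t i : ℂ))
    (continuousOn_pi.2 fun i => Complex.continuous_ofReal.comp_continuousOn
      ((continuous_apply i).comp_continuousOn hc))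
    (fun t ht => by
      rw [hasDerivAt_pi]
      intro i
      have h1 := (hasDerivAt_pi.1 (hd t ht) i).ofReal_comp
      have h2 : (((A *ᵥ z t) i : ℝ) : ℂ) = (M *ᵥ fun i => (z t i : ℂ)) i := by
        rw [hM, Matrix.mulVec, Matrix.mulVec, dotProduct, dotProduct, Complex.ofReal_sum]
        exact Finset.sum_congr rfl fun j _ => Complex.ofReal_mul _ _
      rw [h2] at h1
      exact h1)
    (fun t => by rw [hCH, Matrix.zero_mulVec])
  rw [tendsto_pi_nhds] at hlim ⊢
  intro i
  exact (Complex.continuous_re.tendsto _).comp (hlim i)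

/-! ### Quadratic Lyapunov functions -/

theorem continuous_quadForm {a : ℕ} (P : Matrix (Fin a) (Fin a) ℝ) :
    Continuous fun v : Fin a → ℝ => v ⬝ᵥ P *ᵥ v :=
  continuous_id.dotProduct (continuous_const.matrix_mulVec continuous_id)

theorem dotProduct_mulVec_comm_of_isHermitian {a : ℕ} {P : Matrix (Fin a) (Fin a) ℝ}
    (hP : P.IsHermitian) (v w : Fin a → ℝ) : v ⬝ᵥ P *ᵥ w = w ⬝ᵥ P *ᵥ v := by
  have hT : Pᵀ = P := by simpa [Matrix.conjTranspose_eq_transpose_of_trivial] using hP.eq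
  rw [Matrix.dotProduct_mulVec, ← Matrix.mulVec_transpose, hT, dotProduct_comm]

theorem hasDerivAt_quadForm {a : ℕ} {P : Matrix (Fin a) (Fin a) ℝ} (hP : P.IsHermitian)
    {z : ℝ → Fin a → ℝ} {z' : Fin a → ℝ} {t : ℝ} (hz : HasDerivAt z z' t) :
    HasDerivAt (fun s => z s ⬝ᵥ P *ᵥ z s) (2 * (z t ⬝ᵥ P *ᵥ z')) t := by
  have h1 : HasDerivAt (fun s => z s ⬝ᵥ P *ᵥ z s) (z' ⬝ᵥ P *ᵥ z t + z t ⬝ᵥ P *ᵥ z') t := by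
    simp only [dotProduct, ← Finset.sum_add_distrib]
    exact HasDerivAt.fun_sum fun i _ =>
      (hasDerivAt_pi.1 hz i).mul (hasDerivAt_pi.1 (hasDerivAt_mulVec P hz) i)
  rwa [dotProduct_mulVec_comm_of_isHermitian hP z', ← two_mul] at h1

theorem norm_sq_le_dotProduct_self {a : ℕ} (v : Fin a → ℝ) : ‖v‖ ^ 2 ≤ v ⬝ᵥ v := by
  have h0 : 0 ≤ v ⬝ᵥ v := by simpa using dotProduct_star_self_nonneg v
  have h : ‖v‖ ≤ Real.sqrt (v ⬝ᵥ v) := by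
    rw [pi_norm_le_iff_of_nonneg (Real.sqrt_nonneg _)]
    intro i
    refine Real.le_sqrt_of_sq_le ?_
    rw [Real.norm_eq_abs, sq_abs, sq]
    exact Finset.single_le_sum (f := fun i => v i * v i) (fun j _ => mul_self_nonneg _)
      (Finset.mem_univ i)
  calc ‖v‖ ^ 2 ≤ Real.sqrt (v ⬝ᵥ v) ^ 2 := pow_le_pow_left₀ (norm_nonneg _) h 2
    _ = v ⬝ᵥ v := Real.sq_sqrt h0

theorem quadForm_smul {a : ℕ} (P : Matrix (Fin a) (Fin a) ℝ) (c : ℝ) (v : Fin a → ℝ) :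
    (c • v) ⬝ᵥ P *ᵥ (c • v) = c ^ 2 * (v ⬝ᵥ P *ᵥ v) := by
  rw [Matrix.mulVec_smul, dotProduct_smul, smul_dotProduct, smul_eq_mul, smul_eq_mul]
  ring

/-- A positive definite form is bounded below by a multiple of the squared norm: it attains a
positive minimum on the unit sphere. -/
theorem exists_mul_norm_sq_le_quadForm {a : ℕ} {P : Matrix (Fin a) (Fin a) ℝ} (hP : P.PosDef) :
    ∃ c, 0 < c ∧ ∀ v : Fin a → ℝ, c * ‖v‖ ^ 2 ≤ v ⬝ᵥ P *ᵥ v := by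
  have key : ∃ c, 0 < c ∧ ∀ v ∈ Metric.sphere (0 : Fin a → ℝ) 1, c ≤ v ⬝ᵥ P *ᵥ v := by
    rcases (Metric.sphere (0 : Fin a → ℝ) 1).eq_empty_or_nonempty with h | h
    · exact ⟨1, one_pos, by simp [h]⟩
    · obtain ⟨v, hv, hmin⟩ := (isCompact_sphere (0 : Fin a → ℝ) 1).exists_isMinOn h
        (continuous_quadForm P).continuousOn
      refine ⟨v ⬝ᵥ P *ᵥ v, ?_, fun w hw => hmin hw⟩
      have hv0 : v ≠ 0 := by
        rintro rfl
        simp at hv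
      simpa using hP.dotProduct_mulVec_pos hv0
  obtain ⟨c, hc, hmin⟩ := key
  refine ⟨c, hc, fun v => ?_⟩
  by_cases hv : v = 0
  · simp [hv]
  have hn : ‖v‖ ≠ 0 := norm_ne_zero_iff.2 hv
  have h1 := hmin (‖v‖⁻¹ • v) (by simp [norm_smul, hn])
  rw [quadForm_smul] at h1
  calc c * ‖v‖ ^ 2 ≤ (‖v‖⁻¹ ^ 2 * (v ⬝ᵥ P *ᵥ v)) * ‖v‖ ^ 2 := by gcongr
    _ = v ⬝ᵥ P *ᵥ v := by field_simp

theorem exists_quadForm_le_mul_norm_sq {a : ℕ} (P : Matrix (Fin a) (Fin a) ℝ) :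
    ∃ c, 0 < c ∧ ∀ v : Fin a → ℝ, v ⬝ᵥ P *ᵥ v ≤ c * ‖v‖ ^ 2 := by
  obtain ⟨c, hc⟩ := ((isCompact_sphere (0 : Fin a → ℝ) 1).image
    (continuous_quadForm P)).bddAbove
  refine ⟨max c 1, by positivity, fun v => ?_⟩
  by_cases hv : v = 0
  · simp [hv]
  have hn : ‖v‖ ≠ 0 := norm_ne_zero_iff.2 hv
  have h1 := hc ⟨‖v‖⁻¹ • v, by simp [norm_smul, hn], rfl⟩
  simp only [quadForm_smul] at h1
  calc v ⬝ᵥ P *ᵥ v = (‖v‖⁻¹ ^ 2 * (v ⬝ᵥ P *ᵥ v)) * ‖v‖ ^ 2 := by field_simp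
    _ ≤ max c 1 * ‖v‖ ^ 2 := by
      gcongr
      exact h1.trans (le_max_left _ _)

theorem Matrix.PosDef.quadForm_nonneg {a : ℕ} {P : Matrix (Fin a) (Fin a) ℝ} (hP : P.PosDef)
    (v : Fin a → ℝ) : 0 ≤ v ⬝ᵥ P *ᵥ v := by
  simpa using hP.posSemidef.dotProduct_mulVec_nonneg v

theorem Matrix.PosDef.eq_zero_of_quadForm_nonpos {a : ℕ} {P : Matrix (Fin a) (Fin a) ℝ}
    (hP : P.PosDef) {v : Fin a → ℝ} (hv : v ⬝ᵥ P *ᵥ v ≤ 0) : v = 0 := by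
  by_contra h
  have := hP.dotProduct_mulVec_pos h
  simp only [star_trivial] at this
  linarith

/-- Young's inequality for a positive definite form. -/
theorem Matrix.PosDef.two_mul_dotProduct_le {a : ℕ} {P : Matrix (Fin a) (Fin a) ℝ} (hP : P.PosDef)
    (v w : Fin a → ℝ) : 2 * (v ⬝ᵥ P *ᵥ w) ≤ v ⬝ᵥ P *ᵥ v + w ⬝ᵥ P *ᵥ w := by
  have h := hP.quadForm_nonneg (v - w)
  rw [Matrix.mulVec_sub, dotProduct_sub, sub_dotProduct, sub_dotProduct,
    dotProduct_mulVec_comm_of_isHermitian hP.isHermitian w v] at h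
  linarith

/-! ### Global solutions of one-sided Lipschitz equations -/

/-- Solutions of `ż = F(z) + γ(t)` are unique if `F` is one-sided Lipschitz in a quadratic
metric. -/
theorem eqOn_of_oneSidedLipschitz {a : ℕ} {P : Matrix (Fin a) (Fin a) ℝ} (hP : P.PosDef)
    {F : (Fin a → ℝ) → (Fin a → ℝ)} {c : ℝ}
    (hF : ∀ z w, (z - w) ⬝ᵥ P *ᵥ (F z - F w) ≤ c * ((z - w) ⬝ᵥ P *ᵥ (z - w)))
    {γ : ℝ → Fin a → ℝ} {z w : ℝ → Fin a → ℝ} {T : ℝ}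
    (hz : ContinuousOn z (Icc 0 T)) (hz' : ∀ t ∈ Ioo 0 T, HasDerivAt z (F (z t) + γ t) t)
    (hw : ContinuousOn w (Icc 0 T)) (hw' : ∀ t ∈ Ioo 0 T, HasDerivAt w (F (w t) + γ t) t)
    (h0 : z 0 = w 0) : EqOn z w (Icc 0 T) := by
  intro t ht
  have h := le_mul_exp_of_deriv_le (a := 2 * c)
    (V := fun t => (z t - w t) ⬝ᵥ P *ᵥ (z t - w t))
    ((continuous_quadForm P).comp_continuousOn (hz.sub hw))
    (fun t ht => hasDerivAt_quadForm hP.isHermitian ((hz' t ht).sub (hw' t ht)))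
    (fun t _ => by
      have := hF (z t) (w t)
      rw [add_sub_add_right_eq_sub]
      linarith) t ht
  simp only [h0, sub_self, zero_dotProduct, zero_mul] at h
  exact sub_eq_zero.1 (hP.eq_zero_of_quadForm_nonpos h)

/-- A bounded vector field that is globally Lipschitz in the state and continuous in time has
solutions on every compact time interval. -/
theorem exists_solution_Icc_of_bounded_lipschitz {a : ℕ} {G : ℝ → (Fin a → ℝ) → (Fin a → ℝ)}
    {T : ℝ} (hT : 0 ≤ T) {K M : NNReal} (hlip : ∀ t ∈ Icc 0 T, LipschitzWith K (G t))
    (hcont : ∀ z, ContinuousOn (fun t => G t z) (Icc 0 T))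
    (hM : ∀ t ∈ Icc 0 T, ∀ z, ‖G t z‖ ≤ M) (z₀ : Fin a → ℝ) :
    ∃ z : ℝ → Fin a → ℝ, z 0 = z₀ ∧ ContinuousOn z (Icc 0 T) ∧
      ∀ t ∈ Ioo 0 T, HasDerivAt z (G t (z t)) t := by
  have hpl : IsPicardLindelof G (tmin := 0) (tmax := T) ⟨0, le_rfl, hT⟩ z₀
      (M * T.toNNReal) 0 M K :=
    { lipschitzOnWith := fun t ht => (hlip t ht).lipschitzOnWith
      continuousOn := fun z _ => hcont z
      norm_le := fun t ht z _ => hM t ht z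
      mul_max_le := by
        simp only [sub_zero, sub_self, max_eq_left hT, NNReal.coe_mul, NNReal.coe_zero,
          Real.coe_toNNReal T hT, le_refl] }
  obtain ⟨z, hz0, hz⟩ := hpl.exists_eq_forall_mem_Icc_hasDerivWithinAt₀
  exact ⟨z, hz0, fun t ht => (hz t ht).continuousWithinAt,
    fun t ht => (hz t (Ioo_subset_Icc_self ht)).hasDerivAt (Icc_mem_nhds ht.1 ht.2)⟩

/-- A bound on solutions of the equation `ż = χ(t) (F(z) + γ(t))` that does not depend on the
cutoff `χ`, provided that `0 ≤ χ ≤ 1`. -/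
theorem quadForm_le_of_cutoff {a : ℕ} {P : Matrix (Fin a) (Fin a) ℝ} (hP : P.PosDef)
    {F : (Fin a → ℝ) → (Fin a → ℝ)} {c : ℝ}
    (hF : ∀ z w, (z - w) ⬝ᵥ P *ᵥ (F z - F w) ≤ c * ((z - w) ⬝ᵥ P *ᵥ (z - w)))
    {γ : ℝ → Fin a → ℝ} {T D : ℝ} (hD0 : 0 ≤ D)
    (hD : ∀ t ∈ Icc 0 T, (F 0 + γ t) ⬝ᵥ P *ᵥ (F 0 + γ t) ≤ D)
    {χ : ℝ → ℝ} (hχ0 : ∀ t, 0 ≤ χ t) (hχ1 : ∀ t, χ t ≤ 1) {z : ℝ → Fin a → ℝ}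
    (hz : ContinuousOn z (Icc 0 T))
    (hz' : ∀ t ∈ Ioo 0 T, HasDerivAt z (χ t • (F (z t) + γ t)) t) :
    ∀ t ∈ Icc 0 T, z t ⬝ᵥ P *ᵥ z t
      ≤ (z 0 ⬝ᵥ P *ᵥ z 0 + D / (2 * |c| + 1)) * Real.exp ((2 * |c| + 1) * T) := by
  intro t ht
  have ha : 0 < 2 * |c| + 1 := by positivity
  have hDa : 0 ≤ D / (2 * |c| + 1) := by positivity
  have h := le_mul_exp_of_deriv_le (a := 2 * |c| + 1)
    (V := fun t => z t ⬝ᵥ P *ᵥ z t + D / (2 * |c| + 1))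
    (((continuous_quadForm P).comp_continuousOn hz).add continuousOn_const)
    (fun t ht => (hasDerivAt_quadForm hP.isHermitian (hz' t ht)).add_const _)
    (fun t ht => by
      have hV := hP.quadForm_nonneg (z t)
      have h1 := hF (z t) 0
      rw [sub_zero] at h1
      have h2 := hP.two_mul_dotProduct_le (z t) (F 0 + γ t)
      have h3 := hD t (Ioo_subset_Icc_self ht)
      have h4 : F (z t) + γ t = (F (z t) - F 0) + (F 0 + γ t) := by abel
      have h5 : c * (z t ⬝ᵥ P *ᵥ z t) ≤ |c| * (z t ⬝ᵥ P *ᵥ z t) :=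
        mul_le_mul_of_nonneg_right (le_abs_self c) hV
      rw [mul_add, mul_div_cancel₀ _ ha.ne', Matrix.mulVec_smul, dotProduct_smul, smul_eq_mul, h4,
        Matrix.mulVec_add, dotProduct_add]
      set X := z t ⬝ᵥ P *ᵥ (F (z t) - F 0) + z t ⬝ᵥ P *ᵥ (F 0 + γ t)
      have h6 : 2 * X ≤ (2 * |c| + 1) * (z t ⬝ᵥ P *ᵥ z t) + D := by linarith
      have h7 : 0 ≤ (2 * |c| + 1) * (z t ⬝ᵥ P *ᵥ z t) + D := by positivity
      calc 2 * (χ t * X) = χ t * (2 * X) := by ring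
        _ ≤ χ t * ((2 * |c| + 1) * (z t ⬝ᵥ P *ᵥ z t) + D) :=
          mul_le_mul_of_nonneg_left h6 (hχ0 t)
        _ ≤ (2 * |c| + 1) * (z t ⬝ᵥ P *ᵥ z t) + D := mul_le_of_le_one_left h7 (hχ1 t)) t ht
  have h0 := hP.quadForm_nonneg (z 0)
  calc z t ⬝ᵥ P *ᵥ z t ≤ z t ⬝ᵥ P *ᵥ z t + D / (2 * |c| + 1) := by linarith
    _ ≤ _ := h
    _ ≤ _ := by
      gcongr
      linarith [ht.2]

/-- Solutions on compact intervals. The vector field is multiplied by a smooth cutoff that equals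
`1` on a ball which the a priori bound keeps the solution in, so the cutoff is not seen. -/
theorem exists_solution_Icc {a : ℕ} {P : Matrix (Fin a) (Fin a) ℝ} (hP : P.PosDef)
    {F : (Fin a → ℝ) → (Fin a → ℝ)} (hFc : ContDiff ℝ 1 F) {c : ℝ}
    (hF : ∀ z w, (z - w) ⬝ᵥ P *ᵥ (F z - F w) ≤ c * ((z - w) ⬝ᵥ P *ᵥ (z - w)))
    {γ : ℝ → Fin a → ℝ} {T : ℝ} (hT : 0 ≤ T) (hγ : ContinuousOn γ (Icc 0 T)) (z₀ : Fin a → ℝ) :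
    ∃ z : ℝ → Fin a → ℝ, z 0 = z₀ ∧ ContinuousOn z (Icc 0 T) ∧
      ∀ t ∈ Ioo 0 T, HasDerivAt z (F (z t) + γ t) t := by
  obtain ⟨cP, hcP, hPlow⟩ := exists_mul_norm_sq_le_quadForm hP
  obtain ⟨D, hD⟩ := (isCompact_Icc.image_of_continuousOn
    ((continuous_quadForm P).comp_continuousOn (continuousOn_const.add hγ
      : ContinuousOn (fun t => F 0 + γ t) (Icc 0 T)))).bddAbove
  have hD' : ∀ t ∈ Icc 0 T, (F 0 + γ t) ⬝ᵥ P *ᵥ (F 0 + γ t) ≤ D :=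
    fun t ht => hD (mem_image_of_mem _ ht)
  have hD0 : 0 ≤ D := (hP.quadForm_nonneg _).trans (hD' 0 ⟨le_rfl, hT⟩)
  obtain ⟨Γ, hΓ⟩ := isCompact_Icc.exists_bound_of_continuousOn hγ
  have hΓ0 : 0 ≤ Γ := (norm_nonneg _).trans (hΓ 0 ⟨le_rfl, hT⟩)
  set Bd := (z₀ ⬝ᵥ P *ᵥ z₀ + D / (2 * |c| + 1)) * Real.exp ((2 * |c| + 1) * T) with hBd
  have hr : 0 < Real.sqrt (Bd / cP) + 1 := by positivity
  set χ : ContDiffBump (0 : Fin a → ℝ) := ⟨Real.sqrt (Bd / cP) + 1, Real.sqrt (Bd / cP) + 2, hr,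
    by linarith⟩ with hχ
  have hsupp : HasCompactSupport fun z => χ z • F z := χ.hasCompactSupport.smul_right
  have hsmooth : ContDiff ℝ 1 fun z => χ z • F z := χ.contDiff.smul hFc
  obtain ⟨K₁, hK₁⟩ := hsmooth.lipschitzWith_of_hasCompactSupport hsupp one_ne_zero
  obtain ⟨K₂, hK₂⟩ := (χ.contDiff (n := 1)).lipschitzWith_of_hasCompactSupport χ.hasCompactSupport
    one_ne_zero
  obtain ⟨M, hM⟩ := hsupp.exists_bound_of_continuous hsmooth.continuous
  have hM0 : 0 ≤ M := (norm_nonneg _).trans (hM 0)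
  lift M to NNReal using hM0
  lift Γ to NNReal using hΓ0
  obtain ⟨z, hz0, hz, hz'⟩ := exists_solution_Icc_of_bounded_lipschitz
    (G := fun t z => χ z • (F z + γ t)) hT (K := K₁ + K₂ * Γ) (M := M + Γ)
    (fun t ht => by
      simp only [smul_add]
      refine hK₁.add (LipschitzWith.of_dist_le_mul fun x y => ?_)
      rw [dist_eq_norm, ← sub_smul, norm_smul, NNReal.coe_mul, mul_right_comm]
      have h1 := hK₂.dist_le_mul x y
      rw [dist_eq_norm] at h1
      exact mul_le_mul h1 (hΓ t ht) (norm_nonneg _) (by positivity))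
    (fun z => ContinuousOn.fun_const_smul (ContinuousOn.fun_add continuousOn_const hγ) _)
    (fun t ht z => by
      rw [smul_add]
      refine (norm_add_le _ _).trans (add_le_add (hM z) ?_)
      rw [norm_smul, Real.norm_eq_abs, abs_of_nonneg χ.nonneg]
      exact (mul_le_of_le_one_left (norm_nonneg _) χ.le_one).trans (hΓ t ht)) z₀
  refine ⟨z, hz0, hz, fun t ht => ?_⟩
  have hb := quadForm_le_of_cutoff hP hF hD0 hD' (χ := fun t => χ (z t))
    (fun _ => χ.nonneg) (fun _ => χ.le_one) hz hz' t (Ioo_subset_Icc_self ht)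
  rw [hz0, ← hBd] at hb
  have hnorm : ‖z t‖ ≤ Real.sqrt (Bd / cP) := by
    refine Real.le_sqrt_of_sq_le ?_
    rw [le_div_iff₀ hcP, mul_comm]
    exact (hPlow _).trans hb
  have h1 : χ (z t) = 1 := χ.one_of_mem_closedBall (by
    rw [mem_closedBall_zero_iff]
    exact hnorm.trans (by simp [hχ]))
  have h2 := hz' t ht
  rwa [h1, one_smul] at h2

/-- Global existence for `ż = F(z) + γ(t)` with `F` continuously differentiable and one-sided
Lipschitz in a quadratic metric. -/
theorem exists_global_solution {a : ℕ} {P : Matrix (Fin a) (Fin a) ℝ} (hP : P.PosDef)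
    {F : (Fin a → ℝ) → (Fin a → ℝ)} (hFc : ContDiff ℝ 1 F) {c : ℝ}
    (hF : ∀ z w, (z - w) ⬝ᵥ P *ᵥ (F z - F w) ≤ c * ((z - w) ⬝ᵥ P *ᵥ (z - w)))
    {γ : ℝ → Fin a → ℝ} (hγ : ContinuousOn γ (Ici 0)) (z₀ : Fin a → ℝ) :
    ∃ z : ℝ → Fin a → ℝ, z 0 = z₀ ∧ ContinuousOn z (Ici 0) ∧
      ∀ t, 0 < t → HasDerivAt z (F (z t) + γ t) t := by
  have hex : ∀ N : ℕ, ∃ z : ℝ → Fin a → ℝ, z 0 = z₀ ∧ ContinuousOn z (Icc 0 N) ∧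
      ∀ t ∈ Ioo (0 : ℝ) N, HasDerivAt z (F (z t) + γ t) t := fun N =>
    exists_solution_Icc hP hFc hF (Nat.cast_nonneg N) (hγ.mono Icc_subset_Ici_self) z₀
  choose Z hZ0 hZ hZ' using hex
  have huniq : ∀ M N : ℕ, M ≤ N → EqOn (Z M) (Z N) (Icc 0 M) := fun M N hMN => by
    have hMN' : (M : ℝ) ≤ N := Nat.cast_le.2 hMN
    exact eqOn_of_oneSidedLipschitz hP hF (hZ M) (hZ' M)
      ((hZ N).mono (Icc_subset_Icc_right hMN')) (fun t ht => hZ' N t ⟨ht.1, ht.2.trans_le hMN'⟩)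
      ((hZ0 M).trans (hZ0 N).symm)
  set z : ℝ → Fin a → ℝ := fun t => Z ⌈t⌉₊ t with hz
  have hzN : ∀ N : ℕ, EqOn z (Z N) (Icc 0 N) := fun N t ht =>
    huniq ⌈t⌉₊ N (Nat.ceil_le.2 ht.2) ⟨ht.1, Nat.le_ceil t⟩
  refine ⟨z, ?_, fun t ht => ?_, fun t ht => ?_⟩
  · simp only [hz, hZ0]
  · obtain ⟨N, hN⟩ := exists_nat_gt t
    have h1 := (hZ N).congr (hzN N) t ⟨ht, hN.le⟩
    refine h1.mono_of_mem_nhdsWithin ?_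
    rw [← Ici_inter_Iic]
    exact inter_mem_nhdsWithin _ (Iic_mem_nhds hN)
  · obtain ⟨N, hN⟩ := exists_nat_gt t
    have h1 := (hZ' N t ⟨ht, hN⟩).congr_of_eventuallyEq
      ((hzN N).eventuallyEq_of_mem (Icc_mem_nhds ht hN))
    rwa [← hzN N ⟨ht.le, hN.le⟩] at h1

/-- The linear equation `ż = A z + γ(t)` has global solutions for continuous `γ`. -/
theorem exists_global_solution_linear {n : ℕ} (A : Matrix (Fin n) (Fin n) ℝ)
    {γ : ℝ → Fin n → ℝ} (hγ : ContinuousOn γ (Ici 0)) (z₀ : Fin n → ℝ) :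
    ∃ z : ℝ → Fin n → ℝ, z 0 = z₀ ∧ ContinuousOn z (Ici 0) ∧
      ∀ t, 0 < t → HasDerivAt z (A *ᵥ z t + γ t) t := by
  obtain ⟨c, -, hc⟩ := exists_quadForm_le_mul_norm_sq (Aᵀ * A)
  have hc0 : ContDiff ℝ 1 fun z : Fin n → ℝ => A *ᵥ z :=
    (LinearMap.toContinuousLinearMap (Matrix.mulVecLin A)).contDiff
  refine exists_global_solution (P := 1) (c := (1 + |c|) / 2) Matrix.PosDef.one hc0
    (fun z w => ?_) hγ z₀
  have h1 := (Matrix.PosDef.one (n := Fin n) (R := ℝ)).two_mul_dotProduct_le (z - w)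
    (A *ᵥ (z - w))
  have h2 := hc (z - w)
  have h3 := norm_sq_le_dotProduct_self (z - w)
  have h4 : c * ‖z - w‖ ^ 2 ≤ |c| * ((z - w) ⬝ᵥ (z - w)) := by
    gcongr
    exact le_abs_self c
  rw [← Matrix.mulVec_mulVec, Matrix.dotProduct_mulVec, Matrix.vecMul_transpose] at h2
  rw [← Matrix.mulVec_sub]
  simp only [Matrix.one_mulVec] at h1 ⊢
  linarith

/-! ### Strong dissipativity of the corrected generator -/

theorem jacobian_mulVec {a b : ℕ} (f : (Fin a → ℝ) → (Fin b → ℝ)) (x v : Fin a → ℝ) :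
    jacobian f x *ᵥ v = fderiv ℝ f x v := by
  rw [jacobian, LinearMap.toMatrix'_mulVec]
  rfl

/-- Mean value theorem for a linear functional of a vector-valued map. -/
theorem exists_dotProduct_sub_eq_jacobian {a b : ℕ} {g : (Fin a → ℝ) → (Fin b → ℝ)}
    (hg : ContDiff ℝ 1 g) {c : ℕ} (u : Fin c → ℝ) (M : Matrix (Fin c) (Fin b) ℝ)
    (z w : Fin a → ℝ) :
    ∃ x, u ⬝ᵥ M *ᵥ (g z - g w) = u ⬝ᵥ M *ᵥ (jacobian g x *ᵥ (z - w)) := by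
  have hline : ∀ s : ℝ, HasDerivAt (fun s : ℝ => w + s • (z - w)) (z - w) s := fun s => by
    simpa using ((hasDerivAt_id s).smul_const (z - w)).const_add w
  have hd : ∀ s : ℝ, HasDerivAt (fun s : ℝ => u ⬝ᵥ M *ᵥ g (w + s • (z - w)))
      (u ⬝ᵥ M *ᵥ (jacobian g (w + s • (z - w)) *ᵥ (z - w))) s := fun s => by
    have h1 : HasDerivAt (fun s : ℝ => g (w + s • (z - w)))
        (fderiv ℝ g (w + s • (z - w)) (z - w)) s :=
      ((hg.differentiable one_ne_zero).differentiableAt.hasFDerivAt).comp_hasDerivAt s (hline s)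
    rw [← jacobian_mulVec] at h1
    simp only [dotProduct]
    exact HasDerivAt.fun_sum fun i _ =>
      ((hasDerivAt_pi.1 (hasDerivAt_mulVec M h1) i).const_mul (u i))
  obtain ⟨s, -, hs⟩ := exists_hasDerivAt_eq_slope _ _ one_pos
    (fun s _ => (hd s).continuousAt.continuousWithinAt) (fun s _ => hd s)
  refine ⟨_, Eq.symm (hs.trans ?_)⟩
  rw [Matrix.mulVec_sub, dotProduct_sub]
  simp

theorem dotProduct_symmetrized_mulVec {a : ℕ} {P : Matrix (Fin a) (Fin a) ℝ}
    (hP : P.IsHermitian) (J : Matrix (Fin a) (Fin a) ℝ) (v : Fin a → ℝ) :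
    v ⬝ᵥ (P * J + Jᵀ * P) *ᵥ v = 2 * (v ⬝ᵥ P *ᵥ (J *ᵥ v)) := by
  rw [Matrix.add_mulVec, dotProduct_add, ← Matrix.mulVec_mulVec, ← Matrix.mulVec_mulVec,
    Matrix.dotProduct_mulVec v Jᵀ, Matrix.vecMul_transpose,
    dotProduct_mulVec_comm_of_isHermitian hP (J *ᵥ v), ← two_mul]

theorem DifferentialDetectability.incremental {p ν : ℕ} {f : (Fin ν → ℝ) → (Fin ν → ℝ)}
    {L : Matrix (Fin p) (Fin ν) ℝ} {P : Matrix (Fin ν) (Fin ν) ℝ} {ϱ ε : ℝ}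
    (h : DifferentialDetectability f L P ϱ ε) (hf : ContDiff ℝ 1 f) (z w : Fin ν → ℝ) :
    (z - w) ⬝ᵥ P *ᵥ (f z - f w)
      ≤ ϱ * ((L *ᵥ (z - w)) ⬝ᵥ (L *ᵥ (z - w))) - ε * ((z - w) ⬝ᵥ (z - w)) := by
  obtain ⟨x, hx⟩ := exists_dotProduct_sub_eq_jacobian hf (z - w) P z w
  have h1 := (h.lmi x).dotProduct_mulVec_nonneg (z - w)
  rw [star_trivial, Matrix.sub_mulVec, Matrix.neg_mulVec, Matrix.sub_mulVec, dotProduct_sub,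
    dotProduct_neg, dotProduct_sub, dotProduct_symmetrized_mulVec h.posDef.isHermitian,
    Matrix.smul_mulVec, Matrix.smul_mulVec, Matrix.one_mulVec, ← Matrix.mulVec_mulVec,
    dotProduct_smul, dotProduct_smul, Matrix.dotProduct_mulVec _ Lᵀ, Matrix.vecMul_transpose,
    smul_eq_mul, smul_eq_mul] at h1
  rw [hx]
  linarith

theorem MonotoneOutput.incremental {p ν : ℕ} {c : (Fin ν → ℝ) → (Fin p → ℝ)}
    {L : Matrix (Fin p) (Fin ν) ℝ} {ψ : (Fin p → ℝ) → (Fin p → ℝ)} {R : Matrix (Fin p) (Fin p) ℝ}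
    (h : MonotoneOutput c L ψ R) (s r : Fin p → ℝ) :
    (s - r) ⬝ᵥ (s - r) ≤ (s - r) ⬝ᵥ R *ᵥ (ψ s - ψ r) := by
  obtain ⟨x, hx⟩ := exists_dotProduct_sub_eq_jacobian h.contDiff (s - r) R s r
  have h1 := (h.monotone x).dotProduct_mulVec_nonneg (s - r)
  rw [star_trivial, Matrix.sub_mulVec, dotProduct_sub,
    dotProduct_symmetrized_mulVec h.posDef.isHermitian, Matrix.smul_mulVec, Matrix.one_mulVec,
    dotProduct_smul, smul_eq_mul] at h1
  rw [hx]
  linarith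

theorem dotProduct_mulVec_observerGain {p ν : ℕ} {κ : ℝ} {P : Matrix (Fin ν) (Fin ν) ℝ}
    (hP : P.PosDef) (L : Matrix (Fin p) (Fin ν) ℝ) (R : Matrix (Fin p) (Fin p) ℝ)
    (v : Fin ν → ℝ) (y : Fin p → ℝ) :
    v ⬝ᵥ P *ᵥ (observerGain κ P L R *ᵥ y) = κ * ((L *ᵥ v) ⬝ᵥ R *ᵥ y) := by
  have hPP : P * P⁻¹ = 1 := Matrix.mul_nonsing_inv P ((Matrix.isUnit_iff_isUnit_det P).1 hP.isUnit)
  rw [observerGain, Matrix.smul_mulVec, Matrix.mulVec_smul, dotProduct_smul, smul_eq_mul,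
    Matrix.mulVec_mulVec, ← Matrix.mul_assoc, ← Matrix.mul_assoc, hPP, Matrix.one_mul,
    ← Matrix.mulVec_mulVec, Matrix.dotProduct_mulVec v Lᵀ, Matrix.vecMul_transpose]

/-- The generator field corrected by the output injection `K_η ψ(L η)` is strongly dissipative in
the metric `P`: the output injection compensates the term `ϱ |L e|²` since `κ ≥ ϱ`. -/
theorem corrected_generator_dissipative {p ν : ℕ} {f : (Fin ν → ℝ) → (Fin ν → ℝ)}
    {c : (Fin ν → ℝ) → (Fin p → ℝ)} {L : Matrix (Fin p) (Fin ν) ℝ} {ψ : (Fin p → ℝ) → (Fin p → ℝ)}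
    {R : Matrix (Fin p) (Fin p) ℝ} {P : Matrix (Fin ν) (Fin ν) ℝ} {ϱ ε κ : ℝ}
    (hf : ContDiff ℝ 1 f) (hO1 : MonotoneOutput c L ψ R)
    (hO2 : DifferentialDetectability f L P ϱ ε) (hκ : ϱ ≤ κ) (z w : Fin ν → ℝ) :
    (z - w) ⬝ᵥ P *ᵥ ((f z - observerGain κ P L R *ᵥ ψ (L *ᵥ z))
        - (f w - observerGain κ P L R *ᵥ ψ (L *ᵥ w)))
      ≤ -ε * ((z - w) ⬝ᵥ (z - w)) := by
  have h1 := hO2.incremental hf z w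
  have h2 := hO1.incremental (L *ᵥ z) (L *ᵥ w)
  rw [← Matrix.mulVec_sub] at h2
  have h3 : 0 ≤ (L *ᵥ (z - w)) ⬝ᵥ (L *ᵥ (z - w)) := by
    simpa using dotProduct_star_self_nonneg (L *ᵥ (z - w))
  have h4 := mul_le_mul_of_nonneg_right hκ h3
  have h5 := mul_le_mul_of_nonneg_left h2 (hO2.rho_pos.le.trans hκ)
  rw [sub_sub_sub_comm, ← Matrix.mulVec_sub, Matrix.mulVec_sub P, dotProduct_sub,
    dotProduct_mulVec_observerGain hO2.posDef]
  linarith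

/-- A vanishing perturbation of a strongly dissipative equation has vanishing effect: for
`ė = Δ(t) + w(t)` with `e ⬝ P Δ ≤ -ε |e|²` the quadratic form `e ⬝ P e` is a Lyapunov function. -/
theorem tendsto_zero_of_dissipative {a : ℕ} {P : Matrix (Fin a) (Fin a) ℝ} (hP : P.PosDef)
    {ε : ℝ} (hε : 0 < ε) {e Δ w : ℝ → Fin a → ℝ} (hc : ContinuousOn e (Ici 0))
    (hd : ∀ t, 0 < t → HasDerivAt e (Δ t + w t) t)
    (hΔ : ∀ t, 0 < t → e t ⬝ᵥ P *ᵥ Δ t ≤ -ε * (e t ⬝ᵥ e t)) (hw : Tendsto w atTop (𝓝 0)) :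
    Tendsto e atTop (𝓝 0) := by
  obtain ⟨c₁, hc₁, hlow⟩ := exists_mul_norm_sq_le_quadForm hP
  obtain ⟨c₂, hc₂, hup⟩ := exists_quadForm_le_mul_norm_sq P
  have hV : Tendsto (fun t => e t ⬝ᵥ P *ᵥ e t) atTop (𝓝 0) := by
    refine tendsto_zero_of_deriv_le (a := ε / c₂)
      (g := fun t => (P *ᵥ w t) ⬝ᵥ (P *ᵥ w t) / ε) (by positivity)
      ((continuous_quadForm P).comp_continuousOn hc)
      (fun t ht => hasDerivAt_quadForm hP.isHermitian (hd t ht)) (fun t ht => ?_) ?_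
      (fun t _ => hP.quadForm_nonneg _)
    · have h1 := hΔ t ht
      have h2 : ε / c₂ * (e t ⬝ᵥ P *ᵥ e t) ≤ ε * (e t ⬝ᵥ e t) := by
        rw [div_mul_eq_mul_div, div_le_iff₀ hc₂, mul_assoc]
        refine mul_le_mul_of_nonneg_left ?_ hε.le
        rw [mul_comm]
        exact (hup _).trans (mul_le_mul_of_nonneg_left (norm_sq_le_dotProduct_self _) hc₂.le)
      have h3 : 2 * (e t ⬝ᵥ P *ᵥ w t)
          ≤ ε * (e t ⬝ᵥ e t) + (P *ᵥ w t) ⬝ᵥ (P *ᵥ w t) / ε := by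
        have h4 : 0 ≤ (ε • e t - P *ᵥ w t) ⬝ᵥ (ε • e t - P *ᵥ w t) := by
          simpa using dotProduct_star_self_nonneg (ε • e t - P *ᵥ w t)
        simp only [sub_dotProduct, dotProduct_sub, smul_dotProduct, dotProduct_smul,
          smul_eq_mul] at h4
        rw [dotProduct_comm (P *ᵥ w t) (e t)] at h4
        rw [← sub_le_iff_le_add', le_div_iff₀ hε]
        linarith
      rw [Matrix.mulVec_add, dotProduct_add]
      linarith
    · have h1 : Continuous fun v : Fin a → ℝ => (P *ᵥ v) ⬝ᵥ (P *ᵥ v) / ε := by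
        have h2 : Continuous fun v : Fin a → ℝ => P *ᵥ v :=
          continuous_const.matrix_mulVec continuous_id
        exact (h2.dotProduct h2).div_const ε
      simpa [Function.comp_def] using (h1.tendsto 0).comp hw
  have hsq : Tendsto (fun t => ‖e t‖ ^ 2) atTop (𝓝 0) := by
    refine squeeze_zero (fun t => by positivity) (fun t => ?_)
      (by simpa using hV.div_const c₁)
    rw [le_div_iff₀ hc₁, mul_comm]
    exact hlow _
  rw [tendsto_zero_iff_norm_tendsto_zero]
  simpa using hsq.sqrt

/-! ### Integral equations and differentiation along curves -/

/-- `z` is an indefinite integral of `g` on `[0, ∞)`. -/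
def IsPrimitiveOf {a : ℕ} (z g : ℝ → Fin a → ℝ) : Prop :=
  ∀ t, 0 ≤ t → IntervalIntegrable g volume 0 t ∧ z t = z 0 + ∫ s in (0 : ℝ)..t, g s

theorem IsPrimitiveOf.add {a : ℕ} {z g w k : ℝ → Fin a → ℝ} (hz : IsPrimitiveOf z g)
    (hw : IsPrimitiveOf w k) : IsPrimitiveOf (fun t => z t + w t) (fun t => g t + k t) := by
  intro t ht
  refine ⟨(hz t ht).1.add (hw t ht).1, ?_⟩
  have h1 := (hz t ht).2
  have h2 := (hw t ht).2
  rw [← sub_eq_iff_eq_add'] at h1 h2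
  rw [intervalIntegral.integral_add (hz t ht).1 (hw t ht).1, ← h1, ← h2]
  beta_reduce
  abel

theorem IsPrimitiveOf.sub {a : ℕ} {z g w k : ℝ → Fin a → ℝ} (hz : IsPrimitiveOf z g)
    (hw : IsPrimitiveOf w k) : IsPrimitiveOf (fun t => z t - w t) (fun t => g t - k t) := by
  intro t ht
  refine ⟨(hz t ht).1.sub (hw t ht).1, ?_⟩
  have h1 := (hz t ht).2
  have h2 := (hw t ht).2
  rw [← sub_eq_iff_eq_add'] at h1 h2
  rw [intervalIntegral.integral_sub (hz t ht).1 (hw t ht).1, ← h1, ← h2]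
  beta_reduce
  abel

theorem IsPrimitiveOf.hasDerivAt {a : ℕ} {z g : ℝ → Fin a → ℝ} (hz : IsPrimitiveOf z g)
    (hg : ContinuousOn g (Ici 0)) {t : ℝ} (ht : 0 < t) : HasDerivAt z (g t) t := by
  have hnhds : Ici (0 : ℝ) ∈ 𝓝 t := Ici_mem_nhds ht
  have h1 : HasDerivAt (fun r => z 0 + ∫ s in (0 : ℝ)..r, g s) (g t) t :=
    (intervalIntegral.integral_hasDerivAt_right (hz t ht.le).1
      ⟨Ici 0, hnhds, hg.aestronglyMeasurable measurableSet_Ici⟩ (hg.continuousAt hnhds)).const_add _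
  refine h1.congr_of_eventuallyEq ?_
  filter_upwards [hnhds] with r hr
  exact (hz r hr).2

theorem isPrimitiveOf_of_hasDerivAt {a : ℕ} {z g : ℝ → Fin a → ℝ} (hz : ContinuousOn z (Ici 0))
    (hg : ContinuousOn g (Ici 0)) (hd : ∀ t, 0 < t → HasDerivAt z (g t) t) :
    IsPrimitiveOf z g := by
  intro t ht
  have hint : IntervalIntegrable g volume 0 t :=
    (hg.mono (by rw [uIcc_of_le ht]; exact Icc_subset_Ici_self)).intervalIntegrable
  refine ⟨hint, ?_⟩
  rw [intervalIntegral.integral_eq_sub_of_hasDerivAt_of_le ht (hz.mono Icc_subset_Ici_self)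
    (fun s hs => hd s hs.1) hint]
  abel

/-- A locally integrable function on `[0, ∞)` has a continuous indefinite integral. -/
theorem exists_isPrimitiveOf {a : ℕ} {g : ℝ → Fin a → ℝ}
    (hg : LocallyIntegrableOn g (Ici 0) volume) :
    ∃ U : ℝ → Fin a → ℝ, U 0 = 0 ∧ ContinuousOn U (Ici 0) ∧ IsPrimitiveOf U g := by
  have hint : ∀ t, 0 ≤ t → IntervalIntegrable g volume 0 t := fun t ht => by
    rw [intervalIntegrable_iff_integrableOn_Icc_of_le ht]
    exact hg.integrableOn_compact_subset Icc_subset_Ici_self isCompact_Icc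
  refine ⟨fun t => ∫ s in (0 : ℝ)..t, g s, by simp, fun t ht => ?_,
    fun t ht => ⟨hint t ht, by simp⟩⟩
  have ht' : (0 : ℝ) ≤ t + 1 := by linarith [mem_Ici.1 ht]
  have h1 := intervalIntegral.continuousOn_primitive_interval' (hint (t + 1) ht') left_mem_uIcc
  rw [uIcc_of_le ht'] at h1
  refine (h1 t ⟨ht, by linarith⟩).mono_of_mem_nhdsWithin ?_
  rw [← Ici_inter_Iic]
  exact inter_mem_nhdsWithin _ (Iic_mem_nhds (by linarith))

theorem hasDerivAt_comp_jacobian {a b : ℕ} {g : (Fin a → ℝ) → (Fin b → ℝ)} (hg : ContDiff ℝ 1 g)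
    {z : ℝ → Fin a → ℝ} {z' : Fin a → ℝ} {t : ℝ} (hz : HasDerivAt z z' t) :
    HasDerivAt (fun s => g (z s)) (jacobian g (z t) *ᵥ z') t := by
  rw [jacobian_mulVec]
  exact ((hg.differentiable one_ne_zero).differentiableAt.hasFDerivAt).comp_hasDerivAt t hz

theorem continuousOn_jacobian_mulVec {a b : ℕ} {g : (Fin a → ℝ) → (Fin b → ℝ)}
    (hg : ContDiff ℝ 1 g) {z v : ℝ → Fin a → ℝ} {S : Set ℝ} (hz : ContinuousOn z S)
    (hv : ContinuousOn v S) : ContinuousOn (fun t => jacobian g (z t) *ᵥ v t) S := by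
  simp only [jacobian_mulVec]
  exact ((hg.continuous_fderiv one_ne_zero).comp_continuousOn hz).clm_apply hv

theorem LocallyIntegrableOn.mulVec {a b : ℕ} (M : Matrix (Fin b) (Fin a) ℝ) {g : ℝ → Fin a → ℝ}
    {S : Set ℝ} (hg : LocallyIntegrableOn g S volume) :
    LocallyIntegrableOn (fun t => M *ᵥ g t) S volume := fun t ht => by
  obtain ⟨V, hV, hgV⟩ := hg t ht
  exact ⟨V, hV, (LinearMap.toContinuousLinearMap (Matrix.mulVecLin M)).integrable_comp hgV⟩

/-! ### Plant and observer -/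

/-- Existence of plant trajectories. The difference between the state and the indefinite integral
of the input term `B ū` solves an equation with continuous right-hand side. -/
theorem exists_plantTrajectory {n m ν : ℕ} (A : Matrix (Fin n) (Fin n) ℝ)
    (B : Matrix (Fin n) (Fin m) ℝ) {f : (Fin ν → ℝ) → (Fin ν → ℝ)}
    {h : (Fin ν → ℝ) → (Fin m → ℝ)} (hh : Continuous h) {ubar : ℝ → Fin m → ℝ}
    (hu : LocallyIntegrableOn ubar (Ici 0) volume) {η : ℝ → Fin ν → ℝ}
    (hη : IsSolution (fun _ z => f z) η) (x₀ : Fin n → ℝ) :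
    ∃ x : ℝ → Fin n → ℝ, IsPlantTrajectory A B f h ubar x η ∧ x 0 = x₀ := by
  obtain ⟨U, hU0, hU, hUprim⟩ := exists_isPrimitiveOf (LocallyIntegrableOn.mulVec B hu)
  have hγ : ContinuousOn (fun t => A *ᵥ U t + B *ᵥ h (η t)) (Ici 0) :=
    (continuousOn_mulVec A hU).add (continuousOn_mulVec B (hh.comp_continuousOn hη.1))
  obtain ⟨z, hz0, hz, hz'⟩ := exists_global_solution_linear A hγ x₀
  have hzprim := isPrimitiveOf_of_hasDerivAt hz ((continuousOn_mulVec A hz).add hγ) hz'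
  refine ⟨fun t => z t + U t, ⟨hη, hz.add hU, ?_⟩, by simp [hz0, hU0]⟩
  have h1 := hzprim.add hUprim
  have h2 : (fun t => (A *ᵥ z t + (A *ᵥ U t + B *ᵥ h (η t))) + B *ᵥ ubar t)
      = fun t => A *ᵥ (z t + U t) + B *ᵥ h (η t) + B *ᵥ ubar t := by
    funext t
    rw [Matrix.mulVec_add]
    abel
  rw [← h2]
  exact h1

/-- The invariance equation along a curve with `η̇ = f(η) - w`. -/
theorem SolvesInvariance.jacobian_mulVec_sub {n m ν : ℕ} {A : Matrix (Fin n) (Fin n) ℝ}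
    {B : Matrix (Fin n) (Fin m) ℝ} {f : (Fin ν → ℝ) → (Fin ν → ℝ)}
    {h : (Fin ν → ℝ) → (Fin m → ℝ)} {π : (Fin ν → ℝ) → (Fin n → ℝ)}
    (hπ : SolvesInvariance A B f h π) (η w : Fin ν → ℝ) :
    jacobian π η *ᵥ (f η - w) = A *ᵥ π η + B *ᵥ h η - jacobian π η *ᵥ w := by
  have h1 := hπ.eqn η
  rw [primalInvarianceOp, sub_eq_iff_eq_add'] at h1
  rw [Matrix.mulVec_sub, h1]

/-- In the coordinates `ξ = x - π(η)` the plant and observer states differ by a solution of the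
autonomous equation `ḋ = A d`. -/
theorem hasDerivAt_estimation_error {n m p ν : ℕ} {A : Matrix (Fin n) (Fin n) ℝ}
    {B : Matrix (Fin n) (Fin m) ℝ} {C : Matrix (Fin p) (Fin n) ℝ} {f : (Fin ν → ℝ) → (Fin ν → ℝ)}
    {h : (Fin ν → ℝ) → (Fin m → ℝ)} (hA0 : SmoothGenerator f h) {π : (Fin ν → ℝ) → (Fin n → ℝ)}
    (hπ : SolvesInvariance A B f h π) {K : Matrix (Fin ν) (Fin p) ℝ} {ubar : ℝ → Fin m → ℝ}
    {x xhat : ℝ → Fin n → ℝ} {η etahat : ℝ → Fin ν → ℝ}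
    (hp : IsPlantTrajectory A B f h ubar x η)
    (ho : IsObserverTrajectory A B C f h π K ubar (fun t => C *ᵥ x t) xhat etahat) :
    ContinuousOn (fun t => (xhat t - π (etahat t)) - (x t - π (η t))) (Ici 0) ∧
    (∀ t, 0 < t → HasDerivAt (fun t => (xhat t - π (etahat t)) - (x t - π (η t)))
      (A *ᵥ ((xhat t - π (etahat t)) - (x t - π (η t)))) t) ∧
    (∀ t, 0 < t → HasDerivAt η (f (η t)) t) ∧
    (∀ t, 0 < t → HasDerivAt etahat
      (f (etahat t) - correctionEta C K (C *ᵥ x t) (xhat t)) t) := by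
  have hx := hp.plant.1
  have hxh := ho.state.1
  have hη := hp.generator.1
  have hηh := ho.generator.1
  have hw : ContinuousOn (fun t => correctionEta C K (C *ᵥ x t) (xhat t)) (Ici 0) :=
    continuousOn_mulVec K ((continuousOn_mulVec C hxh).sub (continuousOn_mulVec C hx))
  have hη' : ∀ t, 0 < t → HasDerivAt η (f (η t)) t := fun t ht =>
    IsPrimitiveOf.hasDerivAt hp.generator.2 (hA0.contDiff_f.continuous.comp_continuousOn hη) ht
  have hηh' : ∀ t, 0 < t → HasDerivAt etahat
      (f (etahat t) - correctionEta C K (C *ᵥ x t) (xhat t)) t := fun t ht =>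
    IsPrimitiveOf.hasDerivAt ho.generator.2
      ((hA0.contDiff_f.continuous.comp_continuousOn hηh).sub hw) ht
  have hπc := hπ.contDiff.continuous
  refine ⟨(hxh.sub (hπc.comp_continuousOn hηh)).sub (hx.sub (hπc.comp_continuousOn hη)), ?_,
    hη', hηh'⟩
  -- the input term cancels, so that the difference of the states has a continuous derivative
  have hdiff : IsPrimitiveOf (fun t => xhat t - x t) (fun t => A *ᵥ (xhat t - x t)
      + (B *ᵥ h (etahat t) - B *ᵥ h (η t))
      - correctionX C K π (C *ᵥ x t) (xhat t) (etahat t)) := by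
    have h1 := IsPrimitiveOf.sub ho.state.2 hp.plant.2
    convert h1 using 2 with t
    simp only [Matrix.mulVec_sub]
    abel
  have hcont : ContinuousOn (fun t => A *ᵥ (xhat t - x t)
      + (B *ᵥ h (etahat t) - B *ᵥ h (η t))
      - correctionX C K π (C *ᵥ x t) (xhat t) (etahat t)) (Ici 0) :=
    ((continuousOn_mulVec A (hxh.sub hx)).add
      ((continuousOn_mulVec B (hA0.contDiff_h.continuous.comp_continuousOn hηh)).sub
        (continuousOn_mulVec B (hA0.contDiff_h.continuous.comp_continuousOn hη)))).sub
      (continuousOn_jacobian_mulVec hπ.contDiff hηh hw)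
  intro t ht
  have h1 := ((hdiff.hasDerivAt hcont ht).sub
    (hasDerivAt_comp_jacobian hπ.contDiff (hηh' t ht))).add
    (hasDerivAt_comp_jacobian hπ.contDiff (hη' t ht))
  have h2 := hπ.jacobian_mulVec_sub (η t) 0
  rw [sub_zero, Matrix.mulVec_zero, sub_zero] at h2
  rw [hπ.jacobian_mulVec_sub, h2] at h1
  have h3 : A *ᵥ ((xhat t - π (etahat t)) - (x t - π (η t)))
      = A *ᵥ (xhat t - x t) + (B *ᵥ h (etahat t) - B *ᵥ h (η t))
      - correctionX C K π (C *ᵥ x t) (xhat t) (etahat t)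
      - (A *ᵥ π (etahat t) + B *ᵥ h (etahat t)
        - jacobian π (etahat t) *ᵥ correctionEta C K (C *ᵥ x t) (xhat t))
      + (A *ᵥ π (η t) + B *ᵥ h (η t)) := by
    simp only [Matrix.mulVec_sub, correctionX]
    abel
  rw [h3]
  refine h1.congr_of_eventuallyEq (Eventually.of_forall fun s => ?_)
  simp only [Pi.add_apply, Pi.sub_apply]
  abel

/-- The output error in terms of the error in the coordinates `ξ = x - π(η)`. -/
theorem correctionEta_eq {n p ν : ℕ} {C : Matrix (Fin p) (Fin n) ℝ} (K : Matrix (Fin ν) (Fin p) ℝ)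
    {π : (Fin ν → ℝ) → (Fin n → ℝ)} {L : Matrix (Fin p) (Fin ν) ℝ} {ψ : (Fin p → ℝ) → (Fin p → ℝ)}
    (hψ : ∀ η, C *ᵥ π η = ψ (L *ᵥ η)) (x xhat : Fin n → ℝ) (η etahat : Fin ν → ℝ) :
    correctionEta C K (C *ᵥ x) xhat = K *ᵥ ψ (L *ᵥ etahat) - K *ᵥ ψ (L *ᵥ η)
      + K *ᵥ (C *ᵥ ((xhat - π etahat) - (x - π η))) := by
  rw [correctionEta, ← hψ, ← hψ]
  simp only [Matrix.mulVec_sub]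
  abel

/-- Existence of observer trajectories. In the coordinates `ξ̂ - ξ` and `η̂` the observer is a
cascade of the linear equation `ė = A e` and of a dissipative equation, driven by `e` and `η`. -/
theorem exists_observerTrajectory {n m p ν : ℕ} {A : Matrix (Fin n) (Fin n) ℝ}
    {B : Matrix (Fin n) (Fin m) ℝ} {C : Matrix (Fin p) (Fin n) ℝ} {f : (Fin ν → ℝ) → (Fin ν → ℝ)}
    {h : (Fin ν → ℝ) → (Fin m → ℝ)} (hA0 : SmoothGenerator f h) {π : (Fin ν → ℝ) → (Fin n → ℝ)}
    (hπ : SolvesInvariance A B f h π) {K : Matrix (Fin ν) (Fin p) ℝ}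
    {L : Matrix (Fin p) (Fin ν) ℝ} {ψ : (Fin p → ℝ) → (Fin p → ℝ)} (hψc : ContDiff ℝ 1 ψ)
    (hψ : ∀ η, C *ᵥ π η = ψ (L *ᵥ η)) {P : Matrix (Fin ν) (Fin ν) ℝ} (hP : P.PosDef)
    (hdiss : ∀ z w : Fin ν → ℝ, (z - w) ⬝ᵥ P *ᵥ ((f z - K *ᵥ ψ (L *ᵥ z))
      - (f w - K *ᵥ ψ (L *ᵥ w))) ≤ 0)
    {ubar : ℝ → Fin m → ℝ} {x : ℝ → Fin n → ℝ} {η : ℝ → Fin ν → ℝ}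
    (hp : IsPlantTrajectory A B f h ubar x η) (ξhat₀ : Fin n → ℝ) (etahat₀ : Fin ν → ℝ) :
    ∃ (xhat : ℝ → Fin n → ℝ) (etahat : ℝ → Fin ν → ℝ),
      IsObserverTrajectory A B C f h π K ubar (fun t => C *ᵥ x t) xhat etahat ∧
      xhat 0 - π (etahat 0) = ξhat₀ ∧ etahat 0 = etahat₀ := by
  have hx := hp.plant.1
  have hη := hp.generator.1
  have hη' : ∀ t, 0 < t → HasDerivAt η (f (η t)) t := fun t ht =>
    IsPrimitiveOf.hasDerivAt hp.generator.2 (hA0.contDiff_f.continuous.comp_continuousOn hη) ht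
  have hmul : ∀ {a b : ℕ} (M : Matrix (Fin b) (Fin a) ℝ), ContDiff ℝ 1 fun v => M *ᵥ v :=
    fun M => (LinearMap.toContinuousLinearMap (Matrix.mulVecLin M)).contDiff
  obtain ⟨e, he0, he, he'⟩ := exists_global_solution_linear A (γ := fun _ => 0) continuousOn_const
    (ξhat₀ - (x 0 - π (η 0)))
  simp only [add_zero] at he'
  have hγ : ContinuousOn (fun t => K *ᵥ ψ (L *ᵥ η t) - K *ᵥ (C *ᵥ e t)) (Ici 0) :=
    (continuousOn_mulVec K (hψc.continuous.comp_continuousOn (continuousOn_mulVec L hη))).sub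
      (continuousOn_mulVec K (continuousOn_mulVec C he))
  obtain ⟨etahat, hηh0, hηh, hηh'⟩ := exists_global_solution (P := P) hP
    (F := fun z => f z - K *ᵥ ψ (L *ᵥ z)) (c := 0)
    (hA0.contDiff_f.sub ((hmul K).comp (hψc.comp (hmul L))))
    (fun z w => by simpa using hdiss z w) hγ etahat₀
  set xhat : ℝ → Fin n → ℝ := fun t => x t + (e t + π (etahat t) - π (η t)) with hxhat
  have hπc := hπ.contDiff.continuous
  have hxhc : ContinuousOn xhat (Ici 0) :=
    hx.add ((he.add (hπc.comp_continuousOn hηh)).sub (hπc.comp_continuousOn hη))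
  have hcorr : ∀ t, correctionEta C K (C *ᵥ x t) (xhat t)
      = K *ᵥ ψ (L *ᵥ etahat t) - K *ᵥ ψ (L *ᵥ η t) + K *ᵥ (C *ᵥ e t) := fun t => by
    rw [correctionEta_eq K hψ (x t) (xhat t) (η t) (etahat t)]
    congr 3
    simp only [hxhat]
    abel
  have hw : ContinuousOn (fun t => correctionEta C K (C *ᵥ x t) (xhat t)) (Ici 0) :=
    continuousOn_mulVec K ((continuousOn_mulVec C hxhc).sub (continuousOn_mulVec C hx))
  have hηh'' : ∀ t, 0 < t → HasDerivAt etahat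
      (f (etahat t) - correctionEta C K (C *ᵥ x t) (xhat t)) t := fun t ht => by
    have h1 := hηh' t ht
    have h2 : f (etahat t) - correctionEta C K (C *ᵥ x t) (xhat t)
        = f (etahat t) - K *ᵥ ψ (L *ᵥ etahat t)
          + (K *ᵥ ψ (L *ᵥ η t) - K *ᵥ (C *ᵥ e t)) := by
      rw [hcorr]
      abel
    rwa [h2]
  refine ⟨xhat, etahat, ⟨⟨hxhc, ?_⟩, hηh, ?_⟩, ?_, hηh0⟩
  · have hcorrprim : IsPrimitiveOf (fun t => e t + π (etahat t) - π (η t)) (fun t => A *ᵥ e t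
        + jacobian π (etahat t) *ᵥ (f (etahat t) - correctionEta C K (C *ᵥ x t) (xhat t))
        - jacobian π (η t) *ᵥ f (η t)) :=
      isPrimitiveOf_of_hasDerivAt
        ((he.add (hπc.comp_continuousOn hηh)).sub (hπc.comp_continuousOn hη))
        (((continuousOn_mulVec A he).add (continuousOn_jacobian_mulVec hπ.contDiff hηh
          ((hA0.contDiff_f.continuous.comp_continuousOn hηh).sub hw))).sub
          (continuousOn_jacobian_mulVec hπ.contDiff hη
            (hA0.contDiff_f.continuous.comp_continuousOn hη)))
        (fun t ht => ((he' t ht).add (hasDerivAt_comp_jacobian hπ.contDiff (hηh'' t ht))).sub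
          (hasDerivAt_comp_jacobian hπ.contDiff (hη' t ht)))
    have h1 := IsPrimitiveOf.add hp.plant.2 hcorrprim
    change IsPrimitiveOf xhat _
    convert h1 using 2 with t
    have h2 := hπ.jacobian_mulVec_sub (η t) 0
    rw [sub_zero, Matrix.mulVec_zero, sub_zero] at h2
    rw [hπ.jacobian_mulVec_sub, h2]
    simp only [correctionX]
    have h3 : A *ᵥ xhat t = A *ᵥ x t + A *ᵥ e t + A *ᵥ π (etahat t) - A *ᵥ π (η t) := by
      simp only [hxhat, Matrix.mulVec_add, Matrix.mulVec_sub]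
      abel
    rw [h3]
    abel
  · exact isPrimitiveOf_of_hasDerivAt hηh
      ((hA0.contDiff_f.continuous.comp_continuousOn hηh).sub hw) hηh''
  · simp only [hxhat, he0]
    abel

/-! ### Convergence of the estimates -/

theorem tendsto_euclNorm_zero {a : ℕ} {v : ℝ → Fin a → ℝ} (hv : Tendsto v atTop (𝓝 0)) :
    Tendsto (fun t => euclNorm (v t)) atTop (𝓝 0) := by
  have h1 : Continuous fun v : Fin a → ℝ => euclNorm v :=
    (PiLp.continuous_toLp 2 fun _ : Fin a => ℝ).norm
  have h2 := (h1.tendsto 0).comp hv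
  simpa [euclNorm, Function.comp_def] using h2

/-- A continuous map sends two asymptotically equal curves to asymptotically equal curves if one of
the curves is bounded or if the map is uniformly continuous. -/
theorem tendsto_sub_of_isBounded_or_uniformContinuous {a b : ℕ}
    {g : (Fin a → ℝ) → (Fin b → ℝ)} (hg : Continuous g) {z w : ℝ → Fin a → ℝ}
    (hzw : Tendsto (fun t => z t - w t) atTop (𝓝 0))
    (h : Bornology.IsBounded (w '' Ici 0) ∨ UniformContinuous g) :
    Tendsto (fun t => g (z t) - g (w t)) atTop (𝓝 0) := by
  rw [Metric.tendsto_atTop] at hzw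
  simp only [dist_zero_right, ← dist_eq_norm] at hzw
  -- both curves are eventually in a set on which the map is uniformly continuous
  obtain ⟨S, hS, T, hT⟩ : ∃ S : Set (Fin a → ℝ), UniformContinuousOn g S ∧
      ∃ T, ∀ t ≥ T, z t ∈ S ∧ w t ∈ S := by
    rcases h with h | h
    · obtain ⟨r, hr⟩ := h.subset_closedBall 0
      obtain ⟨T, hT⟩ := hzw 1 one_pos
      refine ⟨Metric.closedBall 0 (r + 1),
        (isCompact_closedBall _ _).uniformContinuousOn_of_continuous hg.continuousOn, max T 0, fun t ht => ?_⟩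
      have h1 := hT t ((le_max_left _ _).trans ht)
      have h2 := hr (mem_image_of_mem w (mem_Ici.2 ((le_max_right _ _).trans ht)))
      rw [Metric.mem_closedBall] at h2
      have h3 := dist_triangle (z t) (w t) 0
      exact ⟨Metric.mem_closedBall.2 (by linarith), Metric.mem_closedBall.2 (by linarith)⟩
    · exact ⟨univ, h.uniformContinuousOn, 0, fun _ _ => ⟨mem_univ _, mem_univ _⟩⟩
  rw [Metric.tendsto_atTop]
  intro δ hδ
  obtain ⟨r, hr, hgr⟩ := Metric.uniformContinuousOn_iff.1 hS δ hδ
  obtain ⟨T', hT'⟩ := hzw r hr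
  refine ⟨max T T', fun t ht => ?_⟩
  have h1 := hT t ((le_max_left _ _).trans ht)
  rw [dist_zero_right, ← dist_eq_norm]
  exact hgr _ h1.1 _ h1.2 (hT' t ((le_max_right _ _).trans ht))

theorem mainTheorem7 {n m p ν : ℕ}
    (A : Matrix (Fin n) (Fin n) ℝ) (B : Matrix (Fin n) (Fin m) ℝ) (C : Matrix (Fin p) (Fin n) ℝ)
    (f : (Fin ν → ℝ) → (Fin ν → ℝ)) (h : (Fin ν → ℝ) → (Fin m → ℝ)) (O : Set (Fin ν → ℝ))
    -- (A0), (A1), (A2)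
    (hA0 : SmoothGenerator f h) (hA1 : IsForwardInvariantDomain f O) (hA2 : IsHurwitz A)
    -- `π = s_p⁻¹(B h)`
    (π : (Fin ν → ℝ) → (Fin n → ℝ)) (hπ : SolvesInvariance A B f h π)
    -- (O1), (O2)
    (L : Matrix (Fin p) (Fin ν) ℝ) (ψ : (Fin p → ℝ) → (Fin p → ℝ)) (R : Matrix (Fin p) (Fin p) ℝ)
    (hO1 : MonotoneOutput (primalSSC C (0 : Matrix (Fin p) (Fin m) ℝ) h π) L ψ R)
    (P : Matrix (Fin ν) (Fin ν) ℝ) (ϱ ε : ℝ) (hO2 : DifferentialDetectability f L P ϱ ε)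
    (κ : ℝ) (hκ : ϱ ≤ κ)
    -- the measured input signal
    (ubar : ℝ → Fin m → ℝ) (hu : LocallyIntegrableOn ubar (Ici 0) volume) :
    -- plant and observer have trajectories on `[0, ∞)` for all initial conditions
    (∀ (x₀ : Fin n → ℝ), ∀ η₀ ∈ O, ∃ (x : ℝ → Fin n → ℝ) (η : ℝ → Fin ν → ℝ),
      IsPlantTrajectory A B f h ubar x η ∧ x 0 = x₀ ∧ η 0 = η₀) ∧
    (∀ (x : ℝ → Fin n → ℝ) (η : ℝ → Fin ν → ℝ), IsPlantTrajectory A B f h ubar x η → η 0 ∈ O →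
      (∀ (ξhat₀ : Fin n → ℝ), ∀ etahat₀ ∈ O,
        ∃ (xhat : ℝ → Fin n → ℝ) (etahat : ℝ → Fin ν → ℝ),
          IsObserverTrajectory A B C f h π (observerGain κ P L R) ubar (fun t => C *ᵥ x t)
            xhat etahat ∧
          xhat 0 - π (etahat 0) = ξhat₀ ∧ etahat 0 = etahat₀) ∧
      -- and the estimation errors converge to zero along all of them
      ∀ (xhat : ℝ → Fin n → ℝ) (etahat : ℝ → Fin ν → ℝ),
        IsObserverTrajectory A B C f h π (observerGain κ P L R) ubar (fun t => C *ᵥ x t)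
          xhat etahat →
        etahat 0 ∈ O →
        Tendsto (fun t => euclNorm ((xhat t - π (etahat t)) - (x t - π (η t)))
          + euclNorm (etahat t - η t)) atTop (𝓝 0) ∧
        (Bornology.IsBounded (η '' Ici 0) ∨ UniformContinuous π →
          Tendsto (fun t => euclNorm (xhat t - x t) + euclNorm (etahat t - η t)) atTop (𝓝 0))) := by
  have hψ : ∀ η, C *ᵥ π η = ψ (L *ᵥ η) := fun η => by
    simpa [primalSSC] using hO1.factor η
  have hdiss := corrected_generator_dissipative hA0.contDiff_f hO1 hO2 hκ
  refine ⟨fun x₀ η₀ hη₀ => ?_, fun x η hp _ => ⟨fun ξhat₀ etahat₀ _ => ?_,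
    fun xhat etahat ho _ => ?_⟩⟩
  · obtain ⟨η, hη, hη0, -⟩ := hA1.forward η₀ hη₀
    obtain ⟨x, hx, hx0⟩ := exists_plantTrajectory A B hA0.contDiff_h.continuous hu hη x₀
    exact ⟨x, η, hx, hx0, hη0⟩
  · refine exists_observerTrajectory hA0 hπ hO1.contDiff hψ hO2.posDef (fun z w => ?_) hp ξhat₀
      etahat₀
    have h1 : 0 ≤ (z - w) ⬝ᵥ (z - w) := by simpa using dotProduct_star_self_nonneg (z - w)
    nlinarith [hdiss z w, mul_nonneg hO2.eps_pos.le h1]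
  · obtain ⟨hdc, hd, hη', hηh'⟩ := hasDerivAt_estimation_error hA0 hπ hp ho
    have hd0 := hA2.tendsto_zero hdc hd
    set K := observerGain κ P L R
    -- the observer correction moves `-K ψ(L η̂)` into the field, leaving the perturbation `-K C e`
    have he0 : Tendsto (fun t => etahat t - η t) atTop (𝓝 0) := by
      refine tendsto_zero_of_dissipative hO2.posDef hO2.eps_pos
        (Δ := fun t => (f (etahat t) - K *ᵥ ψ (L *ᵥ etahat t)) - (f (η t) - K *ᵥ ψ (L *ᵥ η t)))
        (w := fun t => -(K *ᵥ (C *ᵥ ((xhat t - π (etahat t)) - (x t - π (η t))))))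
        (ho.generator.1.sub hp.generator.1) (fun t ht => ?_) (fun t _ => hdiss _ _) ?_
      · have h1 := (hηh' t ht).sub (hη' t ht)
        rw [correctionEta_eq K hψ (x t) (xhat t) (η t) (etahat t)] at h1
        refine h1.congr_deriv ?_
        abel
      · have h1 : Continuous fun v : Fin n → ℝ => -(K *ᵥ (C *ᵥ v)) :=
          (continuous_const.matrix_mulVec (continuous_const.matrix_mulVec continuous_id)).neg
        simpa [Function.comp_def] using (h1.tendsto 0).comp hd0
    refine ⟨by simpa using (tendsto_euclNorm_zero hd0).add (tendsto_euclNorm_zero he0),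
      fun hb => ?_⟩
    have hπ0 := tendsto_sub_of_isBounded_or_uniformContinuous hπ.contDiff.continuous he0 hb
    have hx0 : Tendsto (fun t => xhat t - x t) atTop (𝓝 0) := by
      have h1 := hd0.add hπ0
      rw [add_zero] at h1
      refine h1.congr fun t => ?_
      abel
    simpa using (tendsto_euclNorm_zero hx0).add (tendsto_euclNorm_zero he0)
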